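/- Let $\mathcal H$ be a complex Hilbert space and let $S,T$ be bounded linear operators on $\mathcal H$. Write $|X|=(X^*X)^{1/2}$, let $\|\cdot\|$ be the operator norm, and let $\omega(X)=\sup\{|\langle Xx,x\rangle| : x\in\mathcal H,\ \|x\|=1\}$ be the numerical radius. For positive operators $A,B$ with $A$ invertible put $$A\sharp B=A^{1/2}\left(A^{-1/2}BA^{-1/2}\right)^{1/2}A^{1/2},$$ and for arbitrary positive operators let $A\sharp B$ be the limit, in the strong operator topology, of $(A+\varepsilon I)\sharp(B+\varepsilon I)$ as $\varepsilon\downarrow 0$ (the limit always exists and agrees with the formula when $A$ is invertible). If $f,g$ are non-negative continuous functions on $[0,\infty)$ with $f(t)g(t)=t$ for all $t\ge 0$, then $$\omega(ST)\le\frac12\left\|\left(S\,g^2(|T^*|)\,S^*\right)\sharp|S^*|^2+f(|T|)\,|T|\right\|,$$ where $f(|T|)$ and $g^2(|T^*|)$ are given by the continuous functional calculus. In particular, for every $0\le t\le 1$, $$\omega(ST)\le\frac12\left\|\left(S\,|T^*|^{2(1-t)}S^*\right)\sharp|S^*|^2+|T|^{1+t}\right\|,$$ with the convention $|T^*|^0=I$.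 -/

import Mathlib

open Filter Topology
open scoped NNReal

namespace OperatorInequalities

variable {H : Type*} [NormedAddCommGroup H] [InnerProductSpace ℂ H] [CompleteSpace H]

/-- The numerical radius `ω(A) = sup {|⟨A x, x⟩| : ‖x‖ = 1}` of a bounded operator on a complex
Hilbert space (the set is bounded by `‖A‖`; on the zero space it is empty and the value is `0`). -/
noncomputable def numericalRadius (A : H →L[ℂ] H) : ℝ :=
  sSup {r : ℝ | ∃ x : H, ‖x‖ = 1 ∧ r = ‖inner ℂ (A x) x‖}

/-- The expression `A^{1/2} (A^{-1/2} B A^{-1/2})^{1/2} A^{1/2}`, meaningful for positive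
invertible `A` and positive `B`. -/
noncomputable def geometricMeanFormula (A B : H →L[ℂ] H) : H →L[ℂ] H :=
  CFC.sqrt A * CFC.sqrt (A ^ (-(1 / 2) : ℝ) * B * A ^ (-(1 / 2) : ℝ)) * CFC.sqrt A

/-- `G` is the geometric mean of the positive operators `A` and `B`: the limit, in the strong
operator topology, of `(A + ε) ♯ (B + ε)` as `ε ↓ 0`, where the positive invertible operators
`A + ε`, `B + ε` have the geometric mean given by the formula above. -/
def IsGeometricMean (A B G : H →L[ℂ] H) : Prop :=
  ∀ x : H, Tendsto (fun ε : ℝ => geometricMeanFormula (A + ε • 1) (B + ε • 1) x)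
    (𝓝[>] 0) (𝓝 (G x))

open Classical in
/-- The geometric mean `A ♯ B` of positive operators. Existence of the limit for all positive `A`,
`B` is `isGeometricMean_geometricMean`; for positive `B` and positive invertible `A` the value
is `geometricMeanFormula A B`, see `geometricMean_eq_formula`. -/
noncomputable def geometricMean (A B : H →L[ℂ] H) : H →L[ℂ] H :=
  if h : ∃ G, IsGeometricMean A B G then h.choose else 0

theorem IsGeometricMean.unique {A B G G' : H →L[ℂ] H} (h : IsGeometricMean A B G)
    (h' : IsGeometricMean A B G') : G = G' := by
  ext x
  exact tendsto_nhds_unique (h x) (h' x)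

theorem isStrictlyPositive_add_smul_one {A : H →L[ℂ] H} (hA : 0 ≤ A) {ε : ℝ} (hε : 0 < ε) :
    IsStrictlyPositive (A + ε • (1 : H →L[ℂ] H)) :=
  IsStrictlyPositive.nonneg_add hA (IsStrictlyPositive.smul hε isStrictlyPositive_one)

theorem geometricMeanFormula_nonneg (A B : H →L[ℂ] H) : 0 ≤ geometricMeanFormula A B :=
  (IsSelfAdjoint.of_nonneg (CFC.sqrt_nonneg A)).conjugate_nonneg (CFC.sqrt_nonneg _)

theorem sqrt_mul_rpow_neg_half {A : H →L[ℂ] H} (hA : IsStrictlyPositive A) :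
    CFC.sqrt A * A ^ (-(1 / 2) : ℝ) = 1 := by
  rw [CFC.sqrt_eq_rpow]; exact CFC.rpow_mul_rpow_neg _ hA

theorem rpow_neg_half_mul_sqrt {A : H →L[ℂ] H} (hA : IsStrictlyPositive A) :
    A ^ (-(1 / 2) : ℝ) * CFC.sqrt A = 1 := by
  rw [CFC.sqrt_eq_rpow]; exact CFC.rpow_neg_mul_rpow _ hA

theorem eq_geometricMeanFormula {A B X Q : H →L[ℂ] H} (hA : IsStrictlyPositive A) (hX : 0 ≤ X)
    (hQ : Q * A = 1) (h : X * Q * X = B) : X = geometricMeanFormula A B := by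
  have h1 := sqrt_mul_rpow_neg_half hA
  have h2 := rpow_neg_half_mul_sqrt hA
  have h3 : CFC.sqrt A * CFC.sqrt A = A := CFC.sqrt_mul_sqrt_self A hA.nonneg
  unfold geometricMeanFormula
  set R := CFC.sqrt A
  set P : H →L[ℂ] H := A ^ (-(1 / 2) : ℝ)
  have hP : 0 ≤ P := CFC.rpow_nonneg
  have hPP : P * P = Q := by
    have : Q * (R * R) * (P * P) = P * P := by rw [h3, hQ, one_mul]
    rw [← this, mul_assoc Q, mul_assoc R, ← mul_assoc R P P, h1, one_mul, h1, mul_one]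
  have h4 : CFC.sqrt (P * B * P) = P * X * P := by
    apply CFC.sqrt_unique
    · rw [← h, ← hPP]; simp only [mul_assoc]
    · exact conjugate_nonneg_of_nonneg hX hP
  rw [h4]
  calc X = (R * P) * X * (P * R) := by rw [h1, h2, one_mul, mul_one]
    _ = _ := by simp only [mul_assoc]

theorem geometricMeanFormula_comm {A B : H →L[ℂ] H} (hA : IsStrictlyPositive A)
    (hB : IsStrictlyPositive B) : geometricMeanFormula B A = geometricMeanFormula A B := by
  have h1 := sqrt_mul_rpow_neg_half hB
  have h2 := rpow_neg_half_mul_sqrt hB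
  have h3 : CFC.sqrt B * CFC.sqrt B = B := CFC.sqrt_mul_sqrt_self B hB.nonneg
  have hX : 0 ≤ geometricMeanFormula B A := geometricMeanFormula_nonneg B A
  have hP : 0 ≤ B ^ (-(1 / 2) : ℝ) := CFC.rpow_nonneg
  obtain ⟨Q, hQA, hAQ⟩ : ∃ Q, Q * A = 1 ∧ A * Q = 1 := by
    obtain ⟨u, rfl⟩ := hA.isUnit
    exact ⟨_, u.inv_mul, u.mul_inv⟩
  refine eq_geometricMeanFormula hA hX hQA ?_
  have h4 : CFC.sqrt (B ^ (-(1 / 2) : ℝ) * A * B ^ (-(1 / 2) : ℝ)) *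
      CFC.sqrt (B ^ (-(1 / 2) : ℝ) * A * B ^ (-(1 / 2) : ℝ)) =
      B ^ (-(1 / 2) : ℝ) * A * B ^ (-(1 / 2) : ℝ) :=
    CFC.sqrt_mul_sqrt_self _ (conjugate_nonneg_of_nonneg hA.nonneg hP)
  unfold geometricMeanFormula
  set R := CFC.sqrt B
  set P : H →L[ℂ] H := B ^ (-(1 / 2) : ℝ)
  set K := CFC.sqrt (P * A * P)
  have e1 : R * Q * R * (P * A * P) = 1 := by
    calc R * Q * R * (P * A * P) = R * Q * (R * P) * A * P := by simp only [mul_assoc]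
      _ = R * (Q * A) * P := by rw [h1, mul_one]; simp only [mul_assoc]
      _ = 1 := by rw [hQA, mul_one, h1]
  have e2 : (P * A * P) * (R * Q * R) = 1 := by
    calc (P * A * P) * (R * Q * R) = P * A * (P * R) * Q * R := by simp only [mul_assoc]
      _ = P * (A * Q) * R := by rw [h2, mul_one]; simp only [mul_assoc]
      _ = 1 := by rw [hAQ, mul_one, h2]
  have e3 : K * (R * Q * R) * K = 1 := by
    rw [← h4] at e1 e2
    have l : (R * Q * R * K) * K = 1 := by rw [mul_assoc]; exact e1
    have r : K * (K * (R * Q * R)) = 1 := by rw [← mul_assoc]; exact e2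
    have : R * Q * R * K = K * (R * Q * R) := by
      calc R * Q * R * K = (R * Q * R * K) * (K * (K * (R * Q * R))) := by rw [r, mul_one]
        _ = (R * Q * R * K * K) * (K * (R * Q * R)) := by simp only [mul_assoc]
        _ = _ := by rw [l, one_mul]
    rw [← this]; exact l
  calc R * K * R * Q * (R * K * R) = R * (K * (R * Q * R) * K) * R := by simp only [mul_assoc]
    _ = B := by rw [e3, mul_one, h3]

theorem geometricMeanFormula_mono_right (A : H →L[ℂ] H) {B B' : H →L[ℂ] H} (h : B ≤ B') :
    geometricMeanFormula A B ≤ geometricMeanFormula A B' := by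
  refine conjugate_le_conjugate_of_nonneg ?_ (CFC.sqrt_nonneg A)
  exact CFC.sqrt_le_sqrt _ _ (conjugate_le_conjugate_of_nonneg h CFC.rpow_nonneg)

theorem geometricMeanFormula_mono {A A' B B' : H →L[ℂ] H} (hA : IsStrictlyPositive A)
    (hA' : IsStrictlyPositive A') (hB' : IsStrictlyPositive B')
    (hAA : A ≤ A') (hBB : B ≤ B') : geometricMeanFormula A B ≤ geometricMeanFormula A' B' := by
  refine (geometricMeanFormula_mono_right A hBB).trans ?_
  rw [← geometricMeanFormula_comm hA hB', ← geometricMeanFormula_comm hA' hB']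
  exact geometricMeanFormula_mono_right B' hAA

theorem norm_apply_sq_le {D : H →L[ℂ] H} (hD : 0 ≤ D) (x : H) :
    ‖D x‖ ^ 2 ≤ ‖D‖ * D.reApplyInnerSelf x := by
  set R := CFC.sqrt D
  have hR : 0 ≤ R := CFC.sqrt_nonneg D
  have hRR : R * R = D := CFC.sqrt_mul_sqrt_self D hD
  have hsym := ((ContinuousLinearMap.nonneg_iff_isPositive R).1 hR).isSymmetric
  have hn : ‖R‖ ^ 2 = ‖D‖ := by
    rw [CFC.norm_sqrt D hD, Real.sq_sqrt (norm_nonneg D)]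
  have hq : D.reApplyInnerSelf x = ‖R x‖ ^ 2 := by
    rw [ContinuousLinearMap.reApplyInnerSelf_apply, ← hRR]
    have : inner ℂ ((R * R) x) x = inner ℂ (R x) (R x) := hsym (R x) x
    rw [this, inner_self_eq_norm_sq]
  have : ‖D x‖ ≤ ‖R‖ * ‖R x‖ := by
    rw [← hRR]; exact R.le_opNorm (R x)
  rw [hq, ← hn, ← mul_pow]
  gcongr

/-- A monotone family of positive operators converges strongly as the parameter decreases to `0`. -/
theorem exists_strong_limit {G : ℝ → H →L[ℂ] H} (h0 : ∀ ε, 0 < ε → 0 ≤ G ε)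
    (hG : ∀ ε δ, 0 < ε → ε ≤ δ → G ε ≤ G δ) :
    ∃ L : H →L[ℂ] H, ∀ x, Tendsto (fun ε => G ε x) (𝓝[>] 0) (𝓝 (L x)) := by
  have key : ∀ x : H, ∃ y, Tendsto (fun ε => G ε x) (𝓝[>] 0) (𝓝 y) := by
    intro x
    set q : ℝ → ℝ := fun ε => (G ε).reApplyInnerSelf x with hq
    have hqm : MonotoneOn q (Set.Ioi 0) := by
      intro ε hε δ _ h
      have := ((ContinuousLinearMap.le_def _ _).1 (hG ε δ hε h)).2 x
      simp only [hq, ContinuousLinearMap.reApplyInnerSelf_apply] at this ⊢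
      simpa [inner_sub_left] using this
    have hqb : BddBelow (q '' Set.Ioi 0) := by
      refine ⟨0, ?_⟩
      rintro _ ⟨ε, hε, rfl⟩
      exact ((ContinuousLinearMap.nonneg_iff_isPositive _).1 (h0 ε hε)).2 x
    have hlim := hqm.tendsto_nhdsGT hqb
    have hc : Cauchy (map q (𝓝[>] 0)) := hlim.cauchy_map
    have bound : ∀ ε δ, 0 < ε → 0 < δ → ε ≤ 1 → δ ≤ 1 →
        dist (G ε x) (G δ x) ^ 2 ≤ ‖G 1‖ * dist (q ε) (q δ) := by
      have aux : ∀ ε δ, 0 < ε → 0 < δ → δ ≤ 1 → ε ≤ δ →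
          dist (G ε x) (G δ x) ^ 2 ≤ ‖G 1‖ * dist (q ε) (q δ) := by
        intro ε δ hε hδ hδ1 h
        have hD : 0 ≤ G δ - G ε := sub_nonneg.2 (hG ε δ hε h)
        have hD1 : G δ - G ε ≤ G 1 :=
          (sub_le_self _ (h0 ε hε)).trans (hG δ 1 hδ hδ1)
        have hqd : (G δ - G ε).reApplyInnerSelf x = q δ - q ε := by
          simp [hq, ContinuousLinearMap.reApplyInnerSelf_apply, inner_sub_left]
        have h1 := norm_apply_sq_le hD x
        rw [hqd] at h1
        have h2 : ‖G δ - G ε‖ ≤ ‖G 1‖ := CStarAlgebra.norm_le_norm_of_nonneg_of_le hD hD1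
        have h3 : 0 ≤ q δ - q ε := sub_nonneg.2 (hqm hε hδ h)
        rw [dist_comm, dist_eq_norm, dist_comm, Real.dist_eq, abs_of_nonneg h3]
        exact h1.trans (by gcongr)
      intro ε δ hε hδ hε1 hδ1
      rcases le_total ε δ with h | h
      · exact aux ε δ hε hδ hδ1 h
      · rw [dist_comm, dist_comm (q ε)]; exact aux δ ε hδ hε hε1 h
    refine cauchy_map_iff_exists_tendsto.1 (Metric.cauchy_iff.2 ⟨inferInstance, ?_⟩)
    intro r hr
    obtain ⟨t, ht, htd⟩ := (Metric.cauchy_iff.1 hc).2 (r ^ 2 / (‖G 1‖ + 1)) (by positivity)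
    have hs : q ⁻¹' t ∩ Set.Ioc 0 1 ∈ 𝓝[>] (0 : ℝ) :=
      inter_mem ht (Ioc_mem_nhdsGT one_pos)
    refine ⟨_, image_mem_map hs, ?_⟩
    rintro _ ⟨ε, ⟨hεt, hε⟩, rfl⟩ _ ⟨δ, ⟨hδt, hδ⟩, rfl⟩
    have hd := htd _ hεt _ hδt
    rw [lt_div_iff₀ (by positivity)] at hd
    have hb := bound ε δ hε.1 hδ.1 hε.2 hδ.2
    have : dist (G ε x) (G δ x) ^ 2 < r ^ 2 := by
      have := dist_nonneg (x := q ε) (y := q δ)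
      nlinarith
    exact lt_of_pow_lt_pow_left₀ 2 hr.le this
  choose f hf using key
  exact ⟨continuousLinearMapOfTendsto G (tendsto_pi_nhds.2 hf), hf⟩

/-- For positive operators the limit defining the geometric mean exists. -/
theorem isGeometricMean_geometricMean {A B : H →L[ℂ] H} (hA : 0 ≤ A) (hB : 0 ≤ B) :
    IsGeometricMean A B (geometricMean A B) := by
  have hex : ∃ G, IsGeometricMean A B G := by
    refine exists_strong_limit (fun ε _ => geometricMeanFormula_nonneg _ _) ?_
    intro ε δ hε h
    have hδ := hε.trans_le h
    have hs : ε • (1 : H →L[ℂ] H) ≤ δ • 1 := smul_le_smul_of_nonneg_right h zero_le_one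
    exact geometricMeanFormula_mono (isStrictlyPositive_add_smul_one hA hε)
      (isStrictlyPositive_add_smul_one hA hδ)
      (isStrictlyPositive_add_smul_one hB hδ) (by gcongr) (by gcongr)
  rw [geometricMean, dif_pos hex]
  exact hex.choose_spec

/-- For invertible `A` the geometric mean is given by the formula. -/
theorem geometricMean_eq_formula {A B : H →L[ℂ] H} (hA : IsStrictlyPositive A) (hB : 0 ≤ B) :
    geometricMean A B = geometricMeanFormula A B := by
  refine (isGeometricMean_geometricMean hA.nonneg hB).unique fun x => ?_
  have hmem : ∀ᶠ ε : ℝ in 𝓝[>] 0, 0 < ε := self_mem_nhdsWithin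
  have hadd : ∀ C : H →L[ℂ] H,
      Tendsto (fun ε : ℝ => C + ε • (1 : H →L[ℂ] H)) (𝓝[>] 0) (𝓝 C) := by
    intro C
    have : Tendsto (fun ε : ℝ => C + ε • (1 : H →L[ℂ] H)) (𝓝 0) (𝓝 (C + (0 : ℝ) • 1)) :=
      Continuous.tendsto (by fun_prop) 0
    simpa using this.mono_left nhdsWithin_le_nhds
  have hsqrt : ∀ {F : ℝ → H →L[ℂ] H} {C : H →L[ℂ] H}, 0 ≤ C → (∀ ε, 0 < ε → 0 ≤ F ε) →
      Tendsto F (𝓝[>] 0) (𝓝 C) →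
      Tendsto (fun ε => CFC.sqrt (F ε)) (𝓝[>] 0) (𝓝 (CFC.sqrt C)) := by
    intro F C hC hF h
    exact (CFC.continuousOn_sqrt C hC).tendsto.comp
      (tendsto_nhdsWithin_iff.2 ⟨h, hmem.mono hF⟩)
  have hAε := hsqrt hA.nonneg (fun ε hε => (isStrictlyPositive_add_smul_one hA.nonneg hε).nonneg)
    (hadd A)
  have hpow : Tendsto (fun ε : ℝ => (A + ε • (1 : H →L[ℂ] H)) ^ (-(1 / 2) : ℝ)) (𝓝[>] 0)
      (𝓝 (A ^ (-(1 / 2) : ℝ))) :=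
    (CFC.continuousOn_rpow (-(1 / 2)) A hA).tendsto.comp
      (tendsto_nhdsWithin_iff.2 ⟨hadd A, hmem.mono fun ε hε =>
        isStrictlyPositive_add_smul_one hA.nonneg hε⟩)
  have hin := hsqrt (conjugate_nonneg_of_nonneg hB CFC.rpow_nonneg)
    (fun ε hε => conjugate_nonneg_of_nonneg (isStrictlyPositive_add_smul_one hB hε).nonneg
      CFC.rpow_nonneg) ((hpow.mul (hadd B)).mul hpow)
  exact ((ContinuousLinearMap.apply ℂ H x).continuous.tendsto _).comp ((hAε.mul hin).mul hAε)

end OperatorInequalities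

/-! ### Combining two Schwarz-type inequalities by a geometric mean. -/

namespace OperatorInequalities

variable {H : Type*} [NormedAddCommGroup H] [InnerProductSpace ℂ H] [CompleteSpace H]

/-! Put `C = ST`, `A = S g²(|T*|) S*`, `B = |S*|²`, `F = f(|T|)`, `L = |T|`. The mixed Schwarz
inequality (`norm_inner_apply_le`) gives `|⟨Cx,y⟩|² ≤ ‖Fx‖²⟨Ay,y⟩`, and Cauchy–Schwarz gives
`|⟨Cx,y⟩|² ≤ ‖Lx‖²⟨By,y⟩`. Since `F` and `L` commute, these interpolate to `|⟨Cx,x⟩|² ≤ ⟨(A ♯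
B)x,x⟩⟨FLx,x⟩`, and the arithmetic-geometric mean inequality finishes the proof.

The interpolation is `norm_inner_sq_le_geometricMeanFormula`. For invertible data, `A ♯ B = A^{1/2}
K A^{1/2}` with `K = (A^{-1/2} B A^{-1/2})^{1/2}`, and `Y = K^{-1/2} A^{-1/2} C` satisfies `C =
A^{1/2} K^{1/2} Y`. The two hypotheses bound `|⟨Y*Y u,v⟩|` by `‖Fu‖‖Lv‖`;
`reApplyInnerSelf_le_of_norm_inner_le` turns this into `Y*Y ≤ FL`. Positive shifts of all four
operators remove the invertibility assumptions. -/

theorem inner_apply_comm_of_nonneg {H : Type*} [NormedAddCommGroup H] [InnerProductSpace ℂ H]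
    {A : H →L[ℂ] H} (hA : 0 ≤ A) (x y : H) :
    inner ℂ (A x) y = inner ℂ x (A y) :=
  ((ContinuousLinearMap.nonneg_iff_isPositive A).1 hA).isSymmetric x y

theorem reApplyInnerSelf_mul_self {H : Type*} [NormedAddCommGroup H] [InnerProductSpace ℂ H]
    {A : H →L[ℂ] H} (hA : 0 ≤ A) (x : H) :
    (A * A).reApplyInnerSelf x = ‖A x‖ ^ 2 := by
  rw [ContinuousLinearMap.reApplyInnerSelf_apply]
  have : inner ℂ ((A * A) x) x = inner ℂ (A x) (A x) := inner_apply_comm_of_nonneg hA (A x) x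
  rw [this, inner_self_eq_norm_sq]

theorem opNorm_le_one_of_norm_inner_le {H : Type*} [NormedAddCommGroup H]
    [InnerProductSpace ℂ H] {M : H →L[ℂ] H}
    (h : ∀ x y, ‖inner ℂ (M x) y‖ ≤ ‖x‖ * ‖y‖) : ‖M‖ ≤ 1 := by
  refine M.opNorm_le_bound zero_le_one fun x => ?_
  have h1 := h x (M x)
  rw [inner_self_eq_norm_sq_to_K] at h1
  have h2 : ‖M x‖ * ‖M x‖ ≤ ‖x‖ * ‖M x‖ := by simpa [sq] using h1
  rcases (norm_nonneg (M x)).eq_or_lt with h0 | h0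
  · rw [← h0]; positivity
  · rw [one_mul]; exact le_of_mul_le_mul_right h2 h0

/-- A selfadjoint element similar to a contraction is a contraction. -/
theorem IsSelfAdjoint.norm_le_of_conj_unit {A : Type*} [CStarAlgebra A] {Z : A}
    (hZ : IsSelfAdjoint Z) (u : Aˣ) : ‖Z‖ ≤ ‖(u : A) * Z * (↑u⁻¹ : A)‖ := by
  rcases subsingleton_or_nontrivial A with _ | _
  · rw [Subsingleton.elim Z 0]; simp
  -- The spectral radius is invariant under similarity, at most the norm, and equal to it at a
  -- selfadjoint element.
  have h1 : spectralRadius ℂ ((u : A) * Z * (↑u⁻¹ : A)) = spectralRadius ℂ Z := by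
    simp only [spectralRadius, spectrum.units_conjugate]
  have h2 := spectrum.spectralRadius_le_nnnorm (𝕜 := ℂ) ((u : A) * Z * (↑u⁻¹ : A))
  rw [h1, hZ.spectralRadius_eq_nnnorm] at h2
  exact_mod_cast h2

/-- The hypothesis makes `L⁻¹XF⁻¹` a contraction. With `c = F^{1/2}L^{1/2}`, the selfadjoint `Z =
c⁻¹Xc⁻¹` is similar to it, hence also a contraction, so `X = cZc ≤ c² = FL`. -/
theorem reApplyInnerSelf_le_of_norm_inner_le {X F L : H →L[ℂ] H} (hX : 0 ≤ X)
    (hF : IsStrictlyPositive F) (hL : IsStrictlyPositive L) (hFL : Commute F L)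
    (h : ∀ x y, ‖inner ℂ (X x) y‖ ≤ ‖F x‖ * ‖L y‖) (x : H) :
    X.reApplyInnerSelf x ≤ (F * L).reApplyInnerSelf x := by
  have hFa : CFC.sqrt F * CFC.sqrt F = F := CFC.sqrt_mul_sqrt_self F hF.nonneg
  have hLb : CFC.sqrt L * CFC.sqrt L = L := CFC.sqrt_mul_sqrt_self L hL.nonneg
  have ha0 : 0 ≤ CFC.sqrt F := CFC.sqrt_nonneg F
  have hb0 : 0 ≤ CFC.sqrt L := CFC.sqrt_nonneg L
  have hc : Commute (CFC.sqrt F) (CFC.sqrt L) := by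
    have h1 : Commute (CFC.sqrt F) L := hFL.cfcₙ_nnreal NNReal.sqrt
    exact (h1.symm.cfcₙ_nnreal NNReal.sqrt).symm
  obtain ⟨a, ha⟩ : IsUnit (CFC.sqrt F) := by
    have h1 := sqrt_mul_rpow_neg_half hF
    have h2 := rpow_neg_half_mul_sqrt hF
    exact ⟨⟨_, _, h1, h2⟩, rfl⟩
  obtain ⟨b, hb⟩ : IsUnit (CFC.sqrt L) := by
    have h1 := sqrt_mul_rpow_neg_half hL
    have h2 := rpow_neg_half_mul_sqrt hL
    exact ⟨⟨_, _, h1, h2⟩, rfl⟩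
  rw [← ha] at hFa ha0 hc
  rw [← hb] at hLb hb0 hc
  have hc' : Commute a b := Units.ext hc
  have hsa : star (↑a⁻¹ : H →L[ℂ] H) = ↑a⁻¹ := by
    have : star a = a := Units.ext (IsSelfAdjoint.of_nonneg ha0).star_eq
    rw [← Units.coe_star, star_inv, this]
  have hsb : star (↑b⁻¹ : H →L[ℂ] H) = ↑b⁻¹ := by
    have : star b = b := Units.ext (IsSelfAdjoint.of_nonneg hb0).star_eq
    rw [← Units.coe_star, star_inv, this]
  set c : (H →L[ℂ] H)ˣ := a * b with hcdef
  have hcinv : star (↑c⁻¹ : H →L[ℂ] H) = ↑c⁻¹ := by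
    rw [hcdef, mul_inv_rev, Units.val_mul, star_mul, hsa, hsb, ← Units.val_mul, ← Units.val_mul,
      hc'.inv_inv.eq]
  have hcc : (F * L) = c * c := by
    rw [← hFa, ← hLb, hcdef, Units.val_mul]
    calc (a : H →L[ℂ] H) * a * (b * b) = a * (a * b) * b := by simp only [mul_assoc]
      _ = a * (b * a) * b := by rw [hc.eq]
      _ = _ := by simp only [mul_assoc]
  have hc0 : (0 : H →L[ℂ] H) ≤ c := by rw [hcdef, Units.val_mul]; exact hc.mul_nonneg ha0 hb0
  set Z : H →L[ℂ] H := ↑c⁻¹ * X * ↑c⁻¹ with hZ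
  have hZs : IsSelfAdjoint Z := by
    rw [isSelfAdjoint_iff, hZ, star_mul, star_mul, hcinv, (IsSelfAdjoint.of_nonneg hX).star_eq,
      mul_assoc]
  -- This operator is `L⁻¹XF⁻¹`; the hypothesis is applied to `F⁻¹u` and `L⁻¹v`.
  have hM : ‖(↑(b⁻¹ * b⁻¹) * X * ↑(a⁻¹ * a⁻¹) : H →L[ℂ] H)‖ ≤ 1 := by
    refine opNorm_le_one_of_norm_inner_le fun u v => ?_
    have hs : inner ℂ ((↑(b⁻¹ * b⁻¹) * X * ↑(a⁻¹ * a⁻¹) : H →L[ℂ] H) u) v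
        = inner ℂ (X ((↑(a⁻¹ * a⁻¹) : H →L[ℂ] H) u)) ((↑(b⁻¹ * b⁻¹) : H →L[ℂ] H) v) := by
      have hst : star (↑(b⁻¹ * b⁻¹) : H →L[ℂ] H) = ↑(b⁻¹ * b⁻¹) := by
        rw [Units.val_mul, star_mul, hsb]
      rw [ContinuousLinearMap.star_eq_adjoint] at hst
      conv_rhs => rw [← hst, ContinuousLinearMap.adjoint_inner_right]
      rfl
    rw [hs]
    refine (h _ _).trans (le_of_eq ?_)
    have e1 : F * ↑(a⁻¹ * a⁻¹) = 1 := by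
      rw [← hFa, ← Units.val_mul, ← Units.val_mul]; simp
    have e2 : L * ↑(b⁻¹ * b⁻¹) = 1 := by
      rw [← hLb, ← Units.val_mul, ← Units.val_mul]; simp
    rw [← mul_apply_eq_comp, ← mul_apply_eq_comp, e1, e2]
    rfl
  have hZ1 : ‖Z‖ ≤ 1 := by
    refine (IsSelfAdjoint.norm_le_of_conj_unit hZs (b⁻¹ * a)).trans ?_
    have e1 : b⁻¹ * a * c⁻¹ = b⁻¹ * b⁻¹ := by
      rw [hcdef, hc'.eq, mul_inv_rev]; group
    have e2 : c⁻¹ * (b⁻¹ * a)⁻¹ = a⁻¹ * a⁻¹ := by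
      rw [← hc'.inv_right.eq, hcdef, hc'.eq, mul_inv_rev, mul_inv_rev]; group
    have : (↑(b⁻¹ * a) * Z * ↑(b⁻¹ * a)⁻¹ : H →L[ℂ] H) =
        ↑(b⁻¹ * b⁻¹) * X * ↑(a⁻¹ * a⁻¹) := by
      rw [← e1, ← e2, hZ]; simp only [Units.val_mul, mul_assoc]
    rwa [this]
  have hX' : X = c * Z * c := by
    rw [hZ]; simp [mul_assoc]
  have hXx : inner ℂ (X x) x = inner ℂ (Z ((c : H →L[ℂ] H) x)) ((c : H →L[ℂ] H) x) := by
    rw [← inner_apply_comm_of_nonneg hc0]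
    conv_lhs => rw [hX']
    rfl
  rw [hcc, reApplyInnerSelf_mul_self hc0, ContinuousLinearMap.reApplyInnerSelf_apply, hXx]
  refine (re_inner_le_norm _ _).trans ?_
  rw [sq]
  gcongr
  exact (Z.le_opNorm _).trans (mul_le_of_le_one_left (norm_nonneg _) hZ1)

/-- Two Schwarz-type inequalities for `C` combine to one for the geometric means. -/
theorem norm_inner_sq_le_geometricMeanFormula {A B F L C : H →L[ℂ] H}
    (hA : IsStrictlyPositive A) (hB : IsStrictlyPositive B) (hF : IsStrictlyPositive F)
    (hL : IsStrictlyPositive L) (hFL : Commute F L)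
    (hCF : ∀ x y, ‖inner ℂ (C x) y‖ ^ 2 ≤ ‖F x‖ ^ 2 * A.reApplyInnerSelf y)
    (hCL : ∀ x y, ‖inner ℂ (C x) y‖ ^ 2 ≤ ‖L x‖ ^ 2 * B.reApplyInnerSelf y) (x : H) :
    ‖inner ℂ (C x) x‖ ^ 2 ≤
      (geometricMeanFormula A B).reApplyInnerSelf x * (F * L).reApplyInnerSelf x := by
  have h1 := sqrt_mul_rpow_neg_half hA
  have h2 := rpow_neg_half_mul_sqrt hA
  have h3 : CFC.sqrt A * CFC.sqrt A = A := CFC.sqrt_mul_sqrt_self A hA.nonneg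
  have hR : 0 ≤ CFC.sqrt A := CFC.sqrt_nonneg A
  unfold geometricMeanFormula
  set R := CFC.sqrt A
  have hP : 0 ≤ A ^ (-(1 / 2) : ℝ) := CFC.rpow_nonneg
  set P : H →L[ℂ] H := A ^ (-(1 / 2) : ℝ)
  have hD : IsStrictlyPositive (P * B * P) := by
    refine ⟨conjugate_nonneg_of_nonneg hB.nonneg hP, ?_⟩
    have hPu : IsUnit P := ⟨⟨P, R, h2, h1⟩, rfl⟩
    exact (hPu.mul hB.isUnit).mul hPu
  have hKK : CFC.sqrt (P * B * P) * CFC.sqrt (P * B * P) = P * B * P :=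
    CFC.sqrt_mul_sqrt_self _ hD.nonneg
  have hKu : IsStrictlyPositive (CFC.sqrt (P * B * P)) :=
    ⟨CFC.sqrt_nonneg _, ⟨⟨_, _, sqrt_mul_rpow_neg_half hD, rpow_neg_half_mul_sqrt hD⟩, rfl⟩⟩
  set K := CFC.sqrt (P * B * P)
  have hWW : CFC.sqrt K * CFC.sqrt K = K := CFC.sqrt_mul_sqrt_self K hKu.nonneg
  have hW : 0 ≤ CFC.sqrt K := CFC.sqrt_nonneg K
  have hWV := sqrt_mul_rpow_neg_half hKu
  have hVW := rpow_neg_half_mul_sqrt hKu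
  have hV : 0 ≤ K ^ (-(1 / 2) : ℝ) := CFC.rpow_nonneg
  set W := CFC.sqrt K
  set V : H →L[ℂ] H := K ^ (-(1 / 2) : ℝ)
  have hQ : 0 ≤ V * V := (Commute.refl V).mul_nonneg hV hV
  have hKQ : K * (V * V) = 1 := by
    rw [← hWW, mul_assoc, ← mul_assoc W V V, hWV, one_mul, hWV]
  have bF : ∀ u, ‖P (C u)‖ ≤ ‖F u‖ := by
    intro u
    -- The test vector is `A⁻¹Cu`: both `⟨Cu, A⁻¹Cu⟩` and the form of `A` at it equal `‖PCu‖²`.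
    have e := hCF u (P (P (C u)))
    rw [← inner_apply_comm_of_nonneg hP, inner_self_eq_norm_sq_to_K, ← h3,
      reApplyInnerSelf_mul_self hR] at e
    have e' : R (P (P (C u))) = P (C u) := by
      rw [← mul_apply_eq_comp, h1]; rfl
    rw [e'] at e
    have e3 : (‖P (C u)‖ ^ 2) ^ 2 ≤ ‖F u‖ ^ 2 * ‖P (C u)‖ ^ 2 := by simpa using e
    rcases (norm_nonneg (P (C u))).eq_or_lt with h0 | h0
    · rw [← h0]; positivity
    · refine (pow_le_pow_iff_left₀ h0.le (norm_nonneg _) two_ne_zero).1 ?_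
      exact le_of_mul_le_mul_right (by rwa [sq (‖P (C u)‖ ^ 2)] at e3) (pow_pos h0 2)
  have bL : ∀ u, ‖(V * V) (P (C u))‖ ≤ ‖L u‖ := by
    intro u
    set Q := V * V
    -- Since `Q = K⁻¹` and `K² = PBP`, the test vector is `B⁻¹Cu`.
    have e := hCL u (P (Q (Q (P (C u)))))
    rw [← inner_apply_comm_of_nonneg hP, ← inner_apply_comm_of_nonneg hQ,
      inner_self_eq_norm_sq_to_K] at e
    have e' : B.reApplyInnerSelf (P (Q (Q (P (C u))))) = ‖Q (P (C u))‖ ^ 2 := by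
      have e1 : B.reApplyInnerSelf (P (Q (Q (P (C u))))) =
          (P * B * P).reApplyInnerSelf (Q (Q (P (C u)))) := by
        rw [ContinuousLinearMap.reApplyInnerSelf_apply, ContinuousLinearMap.reApplyInnerSelf_apply,
          ← inner_apply_comm_of_nonneg hP]
        rfl
      rw [e1, ← hKK, reApplyInnerSelf_mul_self hKu.nonneg, ← mul_apply_eq_comp K Q, hKQ]
      rfl
    rw [e'] at e
    have e3 : (‖Q (P (C u))‖ ^ 2) ^ 2 ≤ ‖L u‖ ^ 2 * ‖Q (P (C u))‖ ^ 2 := by simpa using e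
    rcases (norm_nonneg (Q (P (C u)))).eq_or_lt with h0 | h0
    · rw [← h0]; positivity
    · refine (pow_le_pow_iff_left₀ h0.le (norm_nonneg _) two_ne_zero).1 ?_
      exact le_of_mul_le_mul_right (by rwa [sq (‖Q (P (C u))‖ ^ 2)] at e3) (pow_pos h0 2)
  -- Splitting `K⁻¹ = V * V` symmetrically makes `⟨Yu,Yv⟩ = ⟨PCu, K⁻¹PCv⟩`, so `bF` and `bL` bound
  -- one factor each.
  set Y : H →L[ℂ] H := V * P * C with hY
  have hYn : ∀ u v, inner ℂ ((star Y * Y) u) v = inner ℂ (Y u) (Y v) := fun u v => by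
    rw [ContinuousLinearMap.star_eq_adjoint]
    exact ContinuousLinearMap.adjoint_inner_left Y v (Y u)
  have key := reApplyInnerSelf_le_of_norm_inner_le (star_mul_self_nonneg Y) hF hL hFL
    (fun u v => by
      rw [hYn]
      have : inner ℂ (Y u) (Y v) = inner ℂ (P (C u)) ((V * V) (P (C v))) :=
        inner_apply_comm_of_nonneg hV (P (C u)) (V (P (C v)))
      rw [this]
      exact (norm_inner_le_norm _ _).trans
        (mul_le_mul (bF u) (bL v) (norm_nonneg _) (norm_nonneg _))) x
  rw [ContinuousLinearMap.reApplyInnerSelf_apply, hYn, inner_self_eq_norm_sq] at key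
  have hG : (R * K * R).reApplyInnerSelf x = ‖W (R x)‖ ^ 2 := by
    rw [← reApplyInnerSelf_mul_self hW, hWW, ContinuousLinearMap.reApplyInnerSelf_apply,
      ContinuousLinearMap.reApplyInnerSelf_apply, ← inner_apply_comm_of_nonneg hR]
    rfl
  have hC : inner ℂ (C x) x = inner ℂ (Y x) (W (R x)) := by
    rw [← inner_apply_comm_of_nonneg hW, ← inner_apply_comm_of_nonneg hR]
    have : R * (W * (V * P * C)) = C := by
      rw [mul_assoc, ← mul_assoc W, hWV, one_mul, ← mul_assoc, h1, one_mul]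
    conv_lhs => rw [← this]
    rfl
  rw [hG, hC]
  calc ‖inner ℂ (Y x) (W (R x))‖ ^ 2 ≤ (‖Y x‖ * ‖W (R x)‖) ^ 2 := by
        gcongr; exact norm_inner_le_norm _ _
    _ = ‖W (R x)‖ ^ 2 * ‖Y x‖ ^ 2 := by ring
    _ ≤ _ := by gcongr

end OperatorInequalities

/-! ### Intertwining relations under the continuous functional calculus. -/

/-- The relation passes to polynomials and then, by Stone–Weierstrass, to uniform limits. Working on
the union of the two spectra lets one function be evaluated at both elements. -/
theorem SemiconjBy.cfc_real_right {A : Type*} [CStarAlgebra A] {x a b : A}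
    (ha : IsSelfAdjoint a) (hb : IsSelfAdjoint b) (h : SemiconjBy x a b) {f : ℝ → ℝ}
    (hf : ContinuousOn f (spectrum ℝ a ∪ spectrum ℝ b)) :
    SemiconjBy x (cfc f a) (cfc f b) := by
  have hsa : spectrum ℝ a ⊆ spectrum ℝ a ∪ spectrum ℝ b := Set.subset_union_left
  have hsb : spectrum ℝ b ⊆ spectrum ℝ a ∪ spectrum ℝ b := Set.subset_union_right
  have hs : IsCompact (spectrum ℝ a ∪ spectrum ℝ b) :=
    (ContinuousFunctionalCalculus.isCompact_spectrum a).union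
      (ContinuousFunctionalCalculus.isCompact_spectrum b)
  have : CompactSpace ↥(spectrum ℝ a ∪ spectrum ℝ b) := isCompact_iff_compactSpace.1 hs
  have key : ∀ F : C(↥(spectrum ℝ a ∪ spectrum ℝ b), ℝ),
      SemiconjBy x (cfcHomSuperset ha hsa F) (cfcHomSuperset hb hsb F) := by
    intro F
    induction F using ContinuousMap.induction_on_of_compact with
    | const r =>
      have h1 : ∀ (c : A) (hc : IsSelfAdjoint c)
          (hsc : spectrum ℝ c ⊆ spectrum ℝ a ∪ spectrum ℝ b),
          cfcHomSuperset hc hsc (ContinuousMap.const _ r) = algebraMap ℝ A r :=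
        fun c hc hsc => AlgHomClass.commutes (cfcHomSuperset hc hsc) r
      rw [h1, h1]
      exact (Algebra.commutes r x).symm
    | id => rwa [cfcHomSuperset_id, cfcHomSuperset_id]
    | star_id => rwa [map_star, map_star, cfcHomSuperset_id, cfcHomSuperset_id, ha.star_eq,
        hb.star_eq]
    | add f g hf hg => rw [map_add, map_add]; exact hf.add_right hg
    | mul f g hf hg => rw [map_mul, map_mul]; exact hf.mul_right hg
    | frequently F hF =>
      have hc : IsClosed {F : C(↥(spectrum ℝ a ∪ spectrum ℝ b), ℝ) |
          x * cfcHomSuperset ha hsa F = cfcHomSuperset hb hsb F * x} :=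
        isClosed_eq (continuous_const.mul (cfcHomSuperset_continuous ha hsa))
          ((cfcHomSuperset_continuous hb hsb).mul continuous_const)
      exact hc.closure_subset (mem_closure_of_frequently_of_tendsto hF tendsto_id)
  have := key ⟨_, hf.domRestrict⟩
  rw [cfc_apply f a ha (hf.mono hsa), cfc_apply f b hb (hf.mono hsb)]
  exact this

theorem SemiconjBy.cfc_nnreal_right {A : Type*} [CStarAlgebra A] [PartialOrder A]
    [StarOrderedRing A] {x a b : A} (ha : 0 ≤ a) (hb : 0 ≤ b) (h : SemiconjBy x a b)
    {f : ℝ≥0 → ℝ≥0} (hf : Continuous f) : SemiconjBy x (cfc f a) (cfc f b) := by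
  rw [cfc_nnreal_eq_real f a ha, cfc_nnreal_eq_real f b hb]
  exact h.cfc_real_right (.of_nonneg ha) (.of_nonneg hb) (by fun_prop)

/-- `a` intertwines `a*a` with `aa*`, hence also their square roots. -/
theorem CFC.mul_abs_eq_abs_star_mul {A : Type*} [CStarAlgebra A] [PartialOrder A]
    [StarOrderedRing A] (a : A) : a * CFC.abs a = CFC.abs (star a) * a := by
  have h : SemiconjBy a (star a * a) (a * star a) := (mul_assoc a (star a) a).symm
  have h' := h.cfc_nnreal_right (star_mul_self_nonneg a) (mul_star_self_nonneg a)
    NNReal.continuous_sqrt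
  have : ∀ c : A, 0 ≤ c → cfc NNReal.sqrt c = CFC.sqrt c := fun c _ => (CFC.sqrt_eq_cfc).symm
  rw [this _ (star_mul_self_nonneg a), this _ (mul_star_self_nonneg a)] at h'
  simpa [CFC.abs] using h'.eq

/-! ### The mixed Schwarz inequality. -/

namespace OperatorInequalities

variable {H : Type*} [NormedAddCommGroup H] [InnerProductSpace ℂ H] [CompleteSpace H]

theorem norm_abs_apply (T : H →L[ℂ] H) (x : H) : ‖CFC.abs T x‖ = ‖T x‖ := by
  have hs : star (CFC.abs T) = CFC.abs T := (IsSelfAdjoint.of_nonneg (CFC.abs_nonneg T)).star_eq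
  have h : ∀ U : H →L[ℂ] H, ‖U x‖ ^ 2 = RCLike.re (inner ℂ ((star U * U) x) x) := by
    intro U
    rw [ContinuousLinearMap.star_eq_adjoint]
    exact U.apply_norm_sq_eq_inner_adjoint_left x
  have : ‖CFC.abs T x‖ ^ 2 = ‖T x‖ ^ 2 := by rw [h, h, hs, CFC.abs_mul_abs]
  exact (sq_eq_sq₀ (norm_nonneg _) (norm_nonneg _)).1 this

/-- An approximate factorization `T ≈ g(|T*|) W f(|T|)` through a contraction `W`. -/
theorem exists_contraction_factorization (T : H →L[ℂ] H) {f g : ℝ≥0 → ℝ≥0} (hf : Continuous f)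
    (hg : Continuous g) (hfg : ∀ t, f t * g t = t) {e : ℝ≥0} (he : 0 < e) :
    ∃ W : H →L[ℂ] H, (∀ z, ‖W z‖ ≤ ‖z‖) ∧
      T = cfc g (CFC.abs (star T)) * W * cfc f (CFC.abs T) + e • W := by
  have hp : 0 ≤ CFC.abs T := CFC.abs_nonneg T
  have hq : 0 ≤ CFC.abs (star T) := CFC.abs_nonneg _
  have hgT : T * cfc g (CFC.abs T) = cfc g (CFC.abs (star T)) * T :=
    SemiconjBy.cfc_nnreal_right hp hq (CFC.mul_abs_eq_abs_star_mul T) hg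
  have hne : ∀ t : ℝ≥0, t + e ≠ 0 := fun t => (by positivity : 0 < t + e).ne'
  obtain ⟨h, hh, hdef⟩ : ∃ h : ℝ≥0 → ℝ≥0, Continuous h ∧ ∀ t, h t = (t + e)⁻¹ :=
    ⟨fun t => (t + e)⁻¹, (continuous_id.add continuous_const).inv₀ hne, fun _ => rfl⟩
  have hgh : Continuous fun t => g t * h t := hg.mul hh
  have hghf : Continuous fun t => g t * h t * f t := hgh.mul hf
  have heh : Continuous fun t => e • h t := hh.const_smul e
  -- `W = T(|T| + e)⁻¹` plays the role of the partial isometry in the polar decomposition; `t/(t +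
  -- e) ≤ 1` makes it a contraction.
  set W : H →L[ℂ] H := T * cfc h (CFC.abs T) with hWdef
  have hWle : ∀ z, ‖W z‖ ≤ ‖z‖ := by
    intro z
    have e1 : CFC.abs T * cfc h (CFC.abs T) = cfc (fun t => t * h t) (CFC.abs T) := by
      rw [cfc_mul (fun t : ℝ≥0 => t) h (CFC.abs T) continuous_id.continuousOn hh.continuousOn, cfc_id' ℝ≥0 (CFC.abs T)]
    have e2 : ‖cfc (fun t => t * h t) (CFC.abs T)‖₊ ≤ 1 := by
      refine nnnorm_cfc_nnreal_le fun t _ => ?_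
      rw [hdef]
      exact mul_inv_le_one_of_le₀ (by simp) zero_le
    calc ‖W z‖ = ‖CFC.abs T (cfc h (CFC.abs T) z)‖ := (norm_abs_apply T _).symm
      _ = ‖cfc (fun t => t * h t) (CFC.abs T) z‖ := by rw [← e1]; rfl
      _ ≤ ‖cfc (fun t => t * h t) (CFC.abs T)‖ * ‖z‖ := ContinuousLinearMap.le_opNorm _ _
      _ ≤ 1 * ‖z‖ := by gcongr; exact_mod_cast e2
      _ = ‖z‖ := one_mul _
  have hdec : T = cfc g (CFC.abs (star T)) * W * cfc f (CFC.abs T) + (e : ℝ≥0) • W := by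
    -- On the spectrum this is `h(t)(f(t)g(t) + e) = h(t)(t + e) = 1`. Multiplying by `T` and moving
    -- `g` across `T` gives the factorization.
    have e1 : cfc g (CFC.abs T) * cfc h (CFC.abs T) * cfc f (CFC.abs T)
        + e • cfc h (CFC.abs T) = 1 := by
      rw [← cfc_mul g h (CFC.abs T) hg.continuousOn hh.continuousOn,
        ← cfc_mul _ f (CFC.abs T) hgh.continuousOn hf.continuousOn,
        ← cfc_smul e h (CFC.abs T) hh.continuousOn,
        ← cfc_add (CFC.abs T) _ _ hghf.continuousOn heh.continuousOn,
        ← cfc_const_one ℝ≥0 (CFC.abs T)]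
      refine cfc_congr fun t _ => ?_
      have : h t * (t + e) = 1 := by rw [hdef, inv_mul_cancel₀ (hne t)]
      calc g t * h t * f t + e • h t = h t * (f t * g t + e) := by
            simp only [smul_eq_mul]; ring
        _ = 1 := by rw [hfg, this]
    rw [hWdef, ← mul_assoc, ← hgT]
    calc T = T * (cfc g (CFC.abs T) * cfc h (CFC.abs T) * cfc f (CFC.abs T)
        + e • cfc h (CFC.abs T)) := by rw [e1, mul_one]
      _ = _ := by rw [mul_add, mul_smul_comm]; simp only [mul_assoc]
  exact ⟨W, hWle, hdec⟩

/-- The mixed Schwarz inequality. -/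
theorem norm_inner_apply_le (T : H →L[ℂ] H) {f g : ℝ≥0 → ℝ≥0} (hf : Continuous f)
    (hg : Continuous g) (hfg : ∀ t, f t * g t = t) (x y : H) :
    ‖inner ℂ (T x) y‖ ≤ ‖cfc f (CFC.abs T) x‖ * ‖cfc g (CFC.abs (star T)) y‖ := by
  have hfac : ∀ e : ℝ≥0, 0 < e → _ := fun e he =>
    exists_contraction_factorization T hf hg hfg he
  have hg0 : 0 ≤ cfc g (CFC.abs (star T)) := cfc_nonneg_of_predicate
  generalize cfc g (CFC.abs (star T)) = G at *
  generalize cfc f (CFC.abs T) = F at *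
  have hW : ∀ e : ℝ≥0, 0 < e → ‖inner ℂ (T x) y‖ ≤ ‖F x‖ * ‖G y‖ + e * (‖x‖ * ‖y‖) := by
    intro e he
    obtain ⟨W, hWle, hdec⟩ := hfac e he
    have hTx : T x = G (W (F x)) + (e : ℝ) • W x := by
      rw [hdec]
      rfl
    rw [hTx, inner_add_left, inner_apply_comm_of_nonneg hg0]
    refine (norm_add_le _ _).trans (add_le_add ?_ ?_)
    · exact (norm_inner_le_norm _ _).trans (by gcongr; exact hWle _)
    · refine (norm_inner_le_norm _ _).trans ?_
      rw [norm_smul, Real.norm_of_nonneg e.coe_nonneg, mul_assoc]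
      exact mul_le_mul_of_nonneg_left (by gcongr; exact hWle _) e.coe_nonneg
  have hlim : Tendsto (fun e : ℝ≥0 => ‖F x‖ * ‖G y‖ + e * (‖x‖ * ‖y‖)) (𝓝[>] 0)
      (𝓝 (‖F x‖ * ‖G y‖ + (0 : ℝ≥0) * (‖x‖ * ‖y‖))) :=
    (Continuous.tendsto (by fun_prop) 0).mono_left nhdsWithin_le_nhds
  simp only [NNReal.coe_zero, zero_mul, add_zero] at hlim
  exact ge_of_tendsto hlim (eventually_mem_nhdsWithin.mono hW)

end OperatorInequalities

/-! ### Numerical radius bounds. -/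

namespace OperatorInequalities

variable {H : Type*} [NormedAddCommGroup H] [InnerProductSpace ℂ H] [CompleteSpace H]

theorem reApplyInnerSelf_nonneg {H : Type*} [NormedAddCommGroup H] [InnerProductSpace ℂ H]
    {A : H →L[ℂ] H} (hA : 0 ≤ A) (x : H) : 0 ≤ A.reApplyInnerSelf x :=
  ((ContinuousLinearMap.nonneg_iff_isPositive A).1 hA).2 x

theorem reApplyInnerSelf_add {H : Type*} [NormedAddCommGroup H] [InnerProductSpace ℂ H]
    (A B : H →L[ℂ] H) (x : H) :
    (A + B).reApplyInnerSelf x = A.reApplyInnerSelf x + B.reApplyInnerSelf x := by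
  simp [ContinuousLinearMap.reApplyInnerSelf_apply, inner_add_left]

theorem reApplyInnerSelf_smul_one {H : Type*} [NormedAddCommGroup H] [InnerProductSpace ℂ H]
    (r : ℝ) (x : H) : (r • (1 : H →L[ℂ] H)).reApplyInnerSelf x = r * ‖x‖ ^ 2 := by
  have : inner ℂ ((r • (1 : H →L[ℂ] H)) x) x = (r : ℂ) * inner ℂ x x := by
    change inner ℂ (r • x) x = _
    rw [← Complex.coe_smul, inner_smul_left, Complex.conj_ofReal]
  rw [ContinuousLinearMap.reApplyInnerSelf_apply, this]
  exact (Complex.re_ofReal_mul r _).trans (congrArg (r * ·) (inner_self_eq_norm_sq (𝕜 := ℂ) x))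

theorem reApplyInnerSelf_conj (S A : H →L[ℂ] H) (y : H) :
    (S * A * star S).reApplyInnerSelf y = A.reApplyInnerSelf (star S y) := by
  rw [ContinuousLinearMap.reApplyInnerSelf_apply, ContinuousLinearMap.reApplyInnerSelf_apply,
    ContinuousLinearMap.star_eq_adjoint, ContinuousLinearMap.adjoint_inner_right]
  rfl

/-- The cross term `2r⟨Fx,x⟩` is nonnegative. Thus shifting `F` or `L` preserves the Schwarz-type
hypotheses. -/
theorem norm_apply_le_norm_add_smul_one_apply {H : Type*} [NormedAddCommGroup H]
    [InnerProductSpace ℂ H] {F : H →L[ℂ] H} (hF : 0 ≤ F) {r : ℝ} (hr : 0 ≤ r)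
    (x : H) : ‖F x‖ ≤ ‖(F + r • (1 : H →L[ℂ] H)) x‖ := by
  have h1 : 0 ≤ RCLike.re (inner ℂ (F x) x) := reApplyInnerSelf_nonneg hF x
  have h2 : RCLike.re (inner ℂ (F x) (r • x)) = r * RCLike.re (inner ℂ (F x) x) := by
    rw [← Complex.coe_smul, inner_smul_right]
    simp
  refine (sq_le_sq₀ (norm_nonneg _) (norm_nonneg _)).1 ?_
  change _ ≤ ‖F x + r • x‖ ^ 2
  rw [norm_add_sq (𝕜 := ℂ), h2]
  have := mul_nonneg hr h1
  nlinarith [sq_nonneg ‖r • x‖]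

/-- A bound for the numerical radius from two Schwarz-type inequalities. -/
theorem IsGeometricMean.numericalRadius_le {A B F L C G : H →L[ℂ] H} (hGlim : IsGeometricMean A B G)
    (hA : 0 ≤ A) (hB : 0 ≤ B) (hF : 0 ≤ F) (hL : 0 ≤ L) (hFL : Commute F L)
    (hCF : ∀ x y, ‖inner ℂ (C x) y‖ ^ 2 ≤ ‖F x‖ ^ 2 * A.reApplyInnerSelf y)
    (hCL : ∀ x y, ‖inner ℂ (C x) y‖ ^ 2 ≤ ‖L x‖ ^ 2 * B.reApplyInnerSelf y) :
    numericalRadius C ≤ 1 / 2 * ‖G + F * L‖ := by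
  have hle : ∀ {D : H →L[ℂ] H} {r : ℝ}, 0 ≤ r → ∀ y : H,
      D.reApplyInnerSelf y ≤ (D + r • (1 : H →L[ℂ] H)).reApplyInnerSelf y := by
    intro D r hr y
    rw [reApplyInnerSelf_add, reApplyInnerSelf_smul_one]
    exact le_add_of_nonneg_right (by positivity)
  -- Separate parameters allow two successive limits: `δ → 0` by norm continuity of the product,
  -- then `ε → 0` by the strong limit defining `G`.
  have hεδ : ∀ ε : ℝ, 0 < ε → ∀ δ : ℝ, 0 < δ → ∀ x : H, ‖inner ℂ (C x) x‖ ^ 2 ≤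
      (geometricMeanFormula (A + ε • 1) (B + ε • 1)).reApplyInnerSelf x *
        ((F + δ • 1) * (L + δ • 1)).reApplyInnerSelf x := by
    intro ε hε δ hδ x
    have hone : ∀ D : H →L[ℂ] H, Commute D (δ • 1) := fun D => (Commute.one_right D).smul_right δ
    refine norm_inner_sq_le_geometricMeanFormula (isStrictlyPositive_add_smul_one hA hε)
      (isStrictlyPositive_add_smul_one hB hε) (isStrictlyPositive_add_smul_one hF hδ)
      (isStrictlyPositive_add_smul_one hL hδ)
      ((hFL.add_right (hone F)).add_left (hone _).symm) ?_ ?_ x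
    · intro u v
      refine (hCF u v).trans ?_
      have h0 := reApplyInnerSelf_nonneg hA v
      gcongr
      · exact norm_apply_le_norm_add_smul_one_apply hF hδ.le u
      · exact hle hε.le v
    · intro u v
      refine (hCL u v).trans ?_
      have h0 := reApplyInnerSelf_nonneg hB v
      gcongr
      · exact norm_apply_le_norm_add_smul_one_apply hL hδ.le u
      · exact hle hε.le v
  have hε : ∀ ε : ℝ, 0 < ε → ∀ x : H, ‖inner ℂ (C x) x‖ ^ 2 ≤
      (geometricMeanFormula (A + ε • 1) (B + ε • 1)).reApplyInnerSelf x *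
        (F * L).reApplyInnerSelf x := by
    intro ε hε x
    have hcont : Continuous fun δ : ℝ =>
        (geometricMeanFormula (A + ε • 1) (B + ε • 1)).reApplyInnerSelf x *
        ((F + δ • 1) * (L + δ • 1)).reApplyInnerSelf x := by
      simp only [ContinuousLinearMap.reApplyInnerSelf_apply]
      have : Continuous fun δ : ℝ => ((F + δ • 1) * (L + δ • 1)) x :=
        by
        have hc : ∀ D : H →L[ℂ] H, Continuous fun δ : ℝ => D + δ • (1 : H →L[ℂ] H) := fun D =>
          continuous_const.add (continuous_id.smul continuous_const)
        exact (ContinuousLinearMap.apply ℂ H x).continuous.comp ((hc F).mul (hc L))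
      exact continuous_const.mul (RCLike.continuous_re.comp (this.inner continuous_const))
    have hlim := (hcont.tendsto 0).mono_left (nhdsWithin_le_nhds (s := Set.Ioi 0))
    simp only [zero_smul, add_zero] at hlim
    exact ge_of_tendsto hlim (eventually_mem_nhdsWithin.mono fun δ hδ => hεδ ε hε δ hδ x)
  have hGx : ∀ x, Tendsto (fun ε : ℝ =>
      (geometricMeanFormula (A + ε • 1) (B + ε • 1)).reApplyInnerSelf x) (𝓝[>] 0)
      (𝓝 (G.reApplyInnerSelf x)) := by
    intro x
    simp only [ContinuousLinearMap.reApplyInnerSelf_apply]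
    exact (RCLike.continuous_re.tendsto _).comp ((hGlim x).inner tendsto_const_nhds)
  refine Real.sSup_le ?_ (by positivity)
  rintro _ ⟨x, hx, rfl⟩
  have h1 : ‖inner ℂ (C x) x‖ ^ 2 ≤ G.reApplyInnerSelf x * (F * L).reApplyInnerSelf x :=
    ge_of_tendsto ((hGx x).mul_const _) (eventually_mem_nhdsWithin.mono fun ε h => hε ε h x)
  have h2 : 0 ≤ G.reApplyInnerSelf x := ge_of_tendsto (hGx x)
    (Eventually.of_forall fun ε => reApplyInnerSelf_nonneg (geometricMeanFormula_nonneg _ _) x)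
  have h3 : 0 ≤ (F * L).reApplyInnerSelf x :=
    reApplyInnerSelf_nonneg (hFL.mul_nonneg hF hL) x
  have h4 : G.reApplyInnerSelf x + (F * L).reApplyInnerSelf x ≤ ‖G + F * L‖ := by
    rw [← reApplyInnerSelf_add]
    refine (re_inner_le_norm _ _).trans ?_
    have := (G + F * L).le_opNorm x
    rwa [hx, mul_one] at this ⊢
  have h5 := norm_nonneg (inner ℂ (C x) x)
  have h6 : 2 * ‖inner ℂ (C x) x‖ ≤ G.reApplyInnerSelf x + (F * L).reApplyInnerSelf x := by
    refine (sq_le_sq₀ (by positivity) (add_nonneg h2 h3)).1 ?_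
    nlinarith [sq_nonneg (G.reApplyInnerSelf x - (F * L).reApplyInnerSelf x)]
  linarith

theorem numericalRadius_mul_le (S T : H →L[ℂ] H) {f g : ℝ≥0 → ℝ≥0} (hf : Continuous f)
    (hg : Continuous g) (hfg : ∀ t, f t * g t = t) :
    numericalRadius (S * T) ≤
      1 / 2 * ‖geometricMean (S * cfc (fun x => g x ^ 2) (CFC.abs (star T)) * star S)
          (CFC.abs (star S) ^ 2) + cfc f (CFC.abs T) * CFC.abs T‖ := by
  have hL : 0 ≤ CFC.abs T := CFC.abs_nonneg T
  have hF : 0 ≤ cfc f (CFC.abs T) := cfc_nonneg_of_predicate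
  have hM : 0 ≤ cfc g (CFC.abs (star T)) := cfc_nonneg_of_predicate
  have hMM : cfc (fun x => g x ^ 2) (CFC.abs (star T)) =
      cfc g (CFC.abs (star T)) * cfc g (CFC.abs (star T)) := by
    rw [← cfc_mul g g (CFC.abs (star T)) hg.continuousOn hg.continuousOn]
    simp only [sq]
  have hFL : Commute (cfc f (CFC.abs T)) (CFC.abs T) := (Commute.refl _).cfc_nnreal f
  have hmix := norm_inner_apply_le T hf hg hfg
  have hT := norm_abs_apply T
  rw [hMM]
  generalize cfc f (CFC.abs T) = F at *
  generalize cfc g (CFC.abs (star T)) = M at *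
  generalize CFC.abs T = L at *
  have hA : 0 ≤ S * (M * M) * star S :=
    star_right_conjugate_nonneg ((Commute.refl M).mul_nonneg hM hM) S
  have hB : 0 ≤ CFC.abs (star S) ^ 2 := by
    rw [CFC.abs_sq]; exact star_mul_self_nonneg _
  have hST : ∀ x y, inner ℂ ((S * T) x) y = inner ℂ (T x) (star S y) := fun x y => by
    rw [ContinuousLinearMap.star_eq_adjoint, ContinuousLinearMap.adjoint_inner_right]
    rfl
  refine (isGeometricMean_geometricMean hA hB).numericalRadius_le hA hB hF hL hFL ?_ ?_
  · intro u v
    rw [hST, reApplyInnerSelf_conj, reApplyInnerSelf_mul_self hM, ← mul_pow]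
    gcongr
    exact hmix u (star S v)
  -- Plain Cauchy–Schwarz: `⟨STu,v⟩ = ⟨Tu,S*v⟩`, with `‖Tu‖ = ‖|T|u‖` and `‖S*v‖² = ⟨|S*|²v,v⟩`.
  · intro u v
    have hS : (CFC.abs (star S) ^ 2).reApplyInnerSelf v = ‖star S v‖ ^ 2 := by
      rw [sq, reApplyInnerSelf_mul_self (CFC.abs_nonneg (star S)), norm_abs_apply]
    rw [hST, hT, hS, ← mul_pow]
    gcongr
    exact norm_inner_le_norm _ _

theorem cfc_rpow_mul_self {A : Type*} [CStarAlgebra A] [PartialOrder A] [StarOrderedRing A] {a : A}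
    (ha : 0 ≤ a) {t : ℝ} (ht : 0 ≤ t) : cfc (fun x : ℝ≥0 => x ^ t) a * a = a ^ (1 + t) := by
  have hc : Continuous fun x : ℝ≥0 => x ^ t := NNReal.continuous_rpow_const ht
  have h := cfc_mul (fun x : ℝ≥0 => x ^ t) (fun x => x) a hc.continuousOn continuous_id.continuousOn
  rw [cfc_id' ℝ≥0 a] at h
  rw [← h, CFC.rpow_def]
  refine cfc_congr fun x _ => ?_
  rw [add_comm, NNReal.rpow_add_of_nonneg x ht zero_le_one, NNReal.rpow_one]

end OperatorInequalities

theorem corollary10 {H : Type*} [NormedAddCommGroup H] [InnerProductSpace ℂ H] [CompleteSpace H]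
    (S T : H →L[ℂ] H) :
    (∀ f g : ℝ≥0 → ℝ≥0, Continuous f → Continuous g → (∀ t, f t * g t = t) →
      OperatorInequalities.numericalRadius (S * T) ≤
        1 / 2 * ‖OperatorInequalities.geometricMean
            (S * cfc (fun x => g x ^ 2) (CFC.abs (star T)) * star S) (CFC.abs (star S) ^ 2)
          + cfc f (CFC.abs T) * CFC.abs T‖) ∧
    (∀ t : ℝ, 0 ≤ t → t ≤ 1 →
      OperatorInequalities.numericalRadius (S * T) ≤
        1 / 2 * ‖OperatorInequalities.geometricMean
            (S * CFC.abs (star T) ^ (2 * (1 - t)) * star S) (CFC.abs (star S) ^ 2)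
          + CFC.abs T ^ (1 + t)‖) := by
  refine ⟨fun f g hf hg hfg => OperatorInequalities.numericalRadius_mul_le S T hf hg hfg,
    fun t h0 h1 => ?_⟩
  -- Take `f(x) = x^t` and `g(x) = x^(1-t)`. At the endpoints `0^0 = 1` keeps both continuous and
  -- agrees with `|T*|^0 = I`.
  have h := OperatorInequalities.numericalRadius_mul_le S T (NNReal.continuous_rpow_const h0)
    (NNReal.continuous_rpow_const (sub_nonneg.2 h1)) fun x => by
      rw [← NNReal.rpow_add_of_nonneg x h0 (sub_nonneg.2 h1), add_sub_cancel, NNReal.rpow_one]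
  have e : (fun x : ℝ≥0 => (x ^ (1 - t)) ^ 2) = fun x => x ^ (2 * (1 - t)) := by
    ext1 x
    rw [mul_comm, NNReal.rpow_mul, NNReal.rpow_two]
  rwa [OperatorInequalities.cfc_rpow_mul_self (CFC.abs_nonneg T) h0, e, ← CFC.rpow_def] at h
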